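/- Let $n\ge 1$. Call a subset of a Euclidean space Jordan measurable if it is bounded and its boundary has Lebesgue measure zero. Let $R:\mathbb R^n\to\mathbb Z^n$ be a quantizer, that is, $R(u+z)=R(u)+z$ for all $u\in\mathbb R^n$, $z\in\mathbb Z^n$, and the cell $V:=R^{-1}(0)$ is Jordan measurable. Let $L\in\mathbb R^{n\times n}$ be iteratively nonresonant: $L$ is nonsingular, and for every finite set of rows of the matrices $L^k$, $k\in\mathbb Z\setminus\{0\}$ (rows being indexed by the pair of $k$ and the row number), these rows together with the $n$ rows of the identity matrix are linearly independent over $\mathbb Q$. Put $T(x):=R(Lx)$ and $E(x):=Lx-T(x)\in V$ for $x\in\mathbb Z^n$, and let $E_k:=E\circ T^{k-1}:\mathbb Z^n\to V$ for $k\ge 1$ (the quantization errors) and $\mathcal E_N:=(E_1,\dots,E_N):\mathbb Z^n\to V^N$ for $N\ge 1$. For $A\subset\mathbb Z^n$ and $N\ge1$ let $\mathcal P_N$ be the class of all boxes $\{x\in\mathbb Z^n: a_k\le x_k<a_k+\ell_k,\ 1\le k\le n\}$ with $a,\ell\in\mathbb Z^n$ and $\min_k \ell_k\ge N$. The set $A$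 is frequency measurable, with frequency $\mathbf F(A)$, if $$\sup_{N\ge1}\inf_{P\in\mathcal P_N}\frac{\#(A\cap P)}{\#P}=\inf_{N\ge1}\sup_{P\in\mathcal P_N}\frac{\#(A\cap P)}{\#P}=\mathbf F(A).$$ A map $g$ from $\mathbb Z^n$ to a metric space $X$ is $D$-distributed, for a Borel probability measure $D$ on $X$, if for every Borel set $B\subset X$ with $D(\partial B)=0$ the set $g^{-1}(B)$ is frequency measurable with $\mathbf F(g^{-1}(B))=D(B)$; the algebra generated by $g$ is then $\mathcal S_g:=\{g^{-1}(B): B\subset X \text{ Borel},\ D(\partial B)=0\}$. For a real matrix $\Lambda$ with $m\ge1$ rows and $n$ columns let $\mathcal Q_m(\Lambda)$ be the class of all sets $\{x\in\mathbb Z^n:\Lambda x\in G+\mathbb Z^m\}$ with $G\subset[0,1)^m$ Jordan measurable. Let $\mathcal Q_N^+:=\mathcal Q_{Nn}(\Lambda_N)$, where $\Lambda_N\in\mathbb R^{Nn\times n}$ is obtained by stacking $L,L^2,\dots,L^N$, and let $\mathcal Q^+$ (the forward algebra) be the union of the classes $\mathcal Q_m(\Lambda)$ over all $m\ge1$ and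 all $m\times n$ submatrices $\Lambda$ of the infinite matrix obtained by stacking $L,L^2,L^3,\dots$. Then the quantization errors are mutually independent, uniformly distributed on $V$ and measurable with respect to $\mathcal Q^+$. Precisely (with $\mathrm{mes}_d$ denoting $d$-dimensional Lebesgue measure, restricted to $V$ or $V^N$, where it is a probability measure): (i) for every $k\ge1$, the map $E_k$ is $\mathrm{mes}_n$-distributed over $V$, and $\mathcal S_{E_k}\subset\mathcal Q^+$; (ii) for every $N\ge1$ and all $A_1\in\mathcal S_{E_1},\dots,A_N\in\mathcal S_{E_N}$, the sets $A_1,\dots,A_N$ and $A_1\cap\dots\cap A_N$ are frequency measurable and $\mathbf F(A_1\cap\dots\cap A_N)=\mathbf F(A_1)\cdots\mathbf F(A_N)$; (iii) for every $N\ge1$, the map $\mathcal E_N$ is $\mathrm{mes}_{Nn}$-distributed over $V^N$, and $\mathcal S_{\mathcal E_N}=\mathcal Q_N^+$. -/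

import Mathlib

open MeasureTheory

noncomputable section

namespace QuantizedLinear

/-! ### Averages and frequencies on the integer lattice -/

/-- An integer vector, regarded as a real vector. -/
def toReal {ι : Type*} (z : ι → ℤ) : ι → ℝ := fun i => (z i : ℝ)

/-- The discrete parallelepiped of the lattice points `x` with `a k ≤ x k < a k + ℓ k`. -/
def box {n : ℕ} (a ℓ : Fin n → ℤ) : Finset (Fin n → ℤ) :=
  Fintype.piFinset fun k => Finset.Ico (a k) (a k + ℓ k)

/-- The class of discrete parallelepipeds all of whose edge lengths are at least `N`. -/
def largeBoxes (n : ℕ) (N : ℕ+) : Set (Finset (Fin n → ℤ)) :=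
  {P | ∃ a ℓ : Fin n → ℤ, (∀ k, (N : ℤ) ≤ ℓ k) ∧ P = box a ℓ}

/-- The average of `f` over a finite set `P` of lattice points. -/
def avgOver {n : ℕ} (f : (Fin n → ℤ) → ℝ) (P : Finset (Fin n → ℤ)) : ℝ :=
  (∑ x ∈ P, f x) / (P.card : ℝ)

/-- The lower average value of a (bounded) function on the lattice. -/
def lowerAvg {n : ℕ} (f : (Fin n → ℤ) → ℝ) : ℝ :=
  ⨆ N : ℕ+, ⨅ P : largeBoxes n N, avgOver f P

/-- The upper average value of a (bounded) function on the lattice. -/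
def upperAvg {n : ℕ} (f : (Fin n → ℤ) → ℝ) : ℝ :=
  ⨅ N : ℕ+, ⨆ P : largeBoxes n N, avgOver f P

/-- The lower frequency of a set of lattice points. -/
def lowerFreq {n : ℕ} (A : Set (Fin n → ℤ)) : ℝ := lowerAvg (A.indicator fun _ => (1 : ℝ))

/-- The upper frequency of a set of lattice points. -/
def upperFreq {n : ℕ} (A : Set (Fin n → ℤ)) : ℝ := upperAvg (A.indicator fun _ => (1 : ℝ))

/-- A set of lattice points is frequency measurable if its lower and upper frequencies agree. -/
def FreqMeasurable {n : ℕ} (A : Set (Fin n → ℤ)) : Prop := lowerFreq A = upperFreq A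

/-- The frequency of a set of lattice points: the common value of the lower and the upper
frequency when the set is frequency measurable. -/
def freq {n : ℕ} (A : Set (Fin n → ℤ)) : ℝ := lowerFreq A

/-- The map `g` on the lattice is `D`-distributed: `D` is a probability measure, and the preimage
of every `D`-continuous Borel set `B` is frequency measurable with frequency `D B`. -/
structure IsDistributed {n : ℕ} {X : Type*} [TopologicalSpace X] [MeasurableSpace X]
    [BorelSpace X] (g : (Fin n → ℤ) → X) (D : Measure X) : Prop where
  isProbabilityMeasure : IsProbabilityMeasure D
  freqMeasurable_preimage :
    ∀ B : Set X, MeasurableSet B → D (frontier B) = 0 → FreqMeasurable (g ⁻¹' B)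
  freq_preimage :
    ∀ B : Set X, MeasurableSet B → D (frontier B) = 0 → freq (g ⁻¹' B) = D.real B

/-- The algebra generated by a `D`-distributed map `g`: the preimages of the `D`-continuous
Borel sets. -/
def generatedAlgebra {n : ℕ} {X : Type*} [TopologicalSpace X] [MeasurableSpace X]
    [BorelSpace X] (g : (Fin n → ℤ) → X) (D : Measure X) : Set (Set (Fin n → ℤ)) :=
  {A | ∃ B : Set X, MeasurableSet B ∧ D (frontier B) = 0 ∧ A = g ⁻¹' B}

/-- Mutual independence, with respect to frequency, of finitely many classes of sets of lattice
points. -/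
def MutuallyIndependent {n N : ℕ} (𝒜 : Fin N → Set (Set (Fin n → ℤ))) : Prop :=
  ∀ A : Fin N → Set (Fin n → ℤ), (∀ k, A k ∈ 𝒜 k) →
    (∀ k, FreqMeasurable (A k)) ∧ FreqMeasurable (⋂ k, A k) ∧
      freq (⋂ k, A k) = ∏ k, freq (A k)

/-! ### Quasiperiodic sets and nonresonance -/

/-- Jordan measurability: a bounded set whose boundary has Lebesgue measure zero. -/
def JordanMeasurable {E : Type*} [PseudoMetricSpace E] [MeasureSpace E] (G : Set E) : Prop :=
  Bornology.IsBounded G ∧ volume (frontier G) = 0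

/-- The set of the lattice points `x` such that `Λ x` lies in `G` up to an integer vector. -/
def quasiperiodicSet {n : ℕ} {ι : Type*} (G : Set (ι → ℝ)) (Λ : Matrix ι (Fin n) ℝ) :
    Set (Fin n → ℤ) :=
  {x | ∃ u ∈ G, ∃ z : ι → ℤ, Λ.mulVec (toReal x) = u + toReal z}

/-- The algebra of `Λ`-quasiperiodic sets, for a matrix `Λ` with finitely many rows. -/
def quasiperiodicAlgebra {n : ℕ} {ι : Type*} [Fintype ι] (Λ : Matrix ι (Fin n) ℝ) :
    Set (Set (Fin n → ℤ)) :=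
  {A | ∃ G : Set (ι → ℝ), G ⊆ {u | ∀ i, u i ∈ Set.Ico (0 : ℝ) 1} ∧ JordanMeasurable G ∧
    A = quasiperiodicSet G Λ}

/-- The algebra of `Λ`-quasiperiodic sets, for a matrix `Λ` with possibly infinitely many rows:
the union of the algebras of all submatrices with finitely many (and at least one) rows. -/
def quasiperiodicAlgebraInf {n : ℕ} {ι : Type*} (Λ : Matrix ι (Fin n) ℝ) :
    Set (Set (Fin n → ℤ)) :=
  {A | ∃ m : ℕ, 0 < m ∧ ∃ r : Fin m ↪ ι, A ∈ quasiperiodicAlgebra (Λ.submatrix r id)}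

/-- A matrix with finitely many rows is nonresonant if its rows, together with the rows of the
identity matrix, are linearly independent over the rationals. -/
def Nonresonant {n : ℕ} {ι : Type*} [Finite ι] (Λ : Matrix ι (Fin n) ℝ) : Prop :=
  LinearIndependent ℚ (Sum.elim (1 : Matrix (Fin n) (Fin n) ℝ).row Λ.row)

/-- A matrix with possibly infinitely many rows is nonresonant if all its submatrices with
finitely many rows are. -/
def NonresonantInf {n : ℕ} {ι : Type*} (Λ : Matrix ι (Fin n) ℝ) : Prop :=
  ∀ m : ℕ, 0 < m → ∀ r : Fin m ↪ ι, Nonresonant (Λ.submatrix r id)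

/-- The matrix formed by stacking all nonzero integer powers of `L`. -/
def allPowers {n : ℕ} (L : Matrix (Fin n) (Fin n) ℝ) :
    Matrix ({k : ℤ // k ≠ 0} × Fin n) (Fin n) ℝ :=
  fun p j => (L ^ (p.1 : ℤ)) p.2 j

/-- The matrix formed by stacking all positive powers of `L`. -/
def positivePowers {n : ℕ} (L : Matrix (Fin n) (Fin n) ℝ) :
    Matrix (ℕ+ × Fin n) (Fin n) ℝ :=
  fun p j => (L ^ (p.1 : ℕ)) p.2 j

/-- The matrix formed by stacking `L, L ^ 2, …, L ^ N`. -/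
def firstPowers {n : ℕ} (L : Matrix (Fin n) (Fin n) ℝ) (N : ℕ) :
    Matrix (Fin N × Fin n) (Fin n) ℝ :=
  fun p j => (L ^ ((p.1 : ℕ) + 1)) p.2 j

/-- A nonsingular matrix is iteratively nonresonant if the matrix formed by its nonzero integer
powers is nonresonant. -/
structure IterativelyNonresonant {n : ℕ} (L : Matrix (Fin n) (Fin n) ℝ) : Prop where
  det_ne_zero : L.det ≠ 0
  nonresonant : NonresonantInf (allPowers L)

/-- The forward algebra. -/
def forwardAlgebra {n : ℕ} (L : Matrix (Fin n) (Fin n) ℝ) : Set (Set (Fin n → ℤ)) :=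
  quasiperiodicAlgebraInf (positivePowers L)

/-- The `N`th algebra of the increasing sequence whose union is the forward algebra. -/
def forwardAlgebraUpTo {n : ℕ} (L : Matrix (Fin n) (Fin n) ℝ) (N : ℕ) :
    Set (Set (Fin n → ℤ)) :=
  quasiperiodicAlgebra (firstPowers L N)

/-! ### Quantized linear systems -/

/-- A quantizer: a map from the space to the lattice which commutes with the translations by
lattice vectors and for which the preimage of zero is Jordan measurable. -/
structure Quantizer (n : ℕ) where
  toFun : (Fin n → ℝ) → (Fin n → ℤ)
  map_add_lattice : ∀ (u : Fin n → ℝ) (z : Fin n → ℤ), toFun (u + toReal z) = toFun u + z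
  jordanMeasurable : JordanMeasurable {u : Fin n → ℝ | toFun u = 0}

/-- The cell of a quantizer: the preimage of zero. -/
def Quantizer.cell {n : ℕ} (R : Quantizer n) : Set (Fin n → ℝ) := {u | R.toFun u = 0}

/-- The `N`th Cartesian power of the cell, a subset of the `N * n`-dimensional space of families
of `N` vectors. -/
def Quantizer.cellPow {n : ℕ} (R : Quantizer n) (N : ℕ) : Set (Fin N → Fin n → ℝ) :=
  {u | ∀ k, u k ∈ R.cell}

/-- Lebesgue measure on a subset of a space, as a measure on its (relative) Borel sets. -/
def lebesgueOn {E : Type*} [MeasureSpace E] (V : Set E) : Measure V :=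
  Measure.comap Subtype.val volume

/-- The transition operator of the quantized linear system. -/
def transition {n : ℕ} (R : Quantizer n) (L : Matrix (Fin n) (Fin n) ℝ) (x : Fin n → ℤ) :
    Fin n → ℤ :=
  R.toFun (L.mulVec (toReal x))

theorem sub_quantizer_mem_cell {n : ℕ} (R : Quantizer n) (u : Fin n → ℝ) :
    u - toReal (R.toFun u) ∈ R.cell := by
  have h := R.map_add_lattice u (-(R.toFun u))
  have e : u + toReal (-(R.toFun u)) = u - toReal (R.toFun u) := by
    ext i
    simp [toReal, sub_eq_add_neg]
  rw [e] at h
  simpa [Quantizer.cell] using h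

/-- The one-step quantization error `L x - T x`, as a map into the cell. -/
def stepError {n : ℕ} (R : Quantizer n) (L : Matrix (Fin n) (Fin n) ℝ) (x : Fin n → ℤ) :
    R.cell :=
  ⟨L.mulVec (toReal x) - toReal (transition R L x), sub_quantizer_mem_cell R _⟩

/-- The `k`th quantization error, for `k = 1, 2, …`. -/
def quantizationError {n : ℕ} (R : Quantizer n) (L : Matrix (Fin n) (Fin n) ℝ) (k : ℕ) :
    (Fin n → ℤ) → R.cell :=
  stepError R L ∘ (transition R L)^[k - 1]

/-- The vector of the first `N` quantization errors, as a map into the power of the cell. -/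
def errorVector {n : ℕ} (R : Quantizer n) (L : Matrix (Fin n) (Fin n) ℝ) (N : ℕ)
    (x : Fin n → ℤ) : R.cellPow N :=
  ⟨fun k => (quantizationError R L ((k : ℕ) + 1) x : Fin n → ℝ),
    fun k => (quantizationError R L ((k : ℕ) + 1) x).2⟩

end QuantizedLinear

end

open QuantizedLinear

/-!
The recursion `E_k = L (T ^ (k - 1) x) - T ^ k x` is triangular, and a linear change of variables
straightens it. Put `y_k = L ^ k x - T ^ k x`. Then `y_k` is an integer translate of `L ^ k x`, and
`E_k = y_k - L y_(k-1)`. Hence, if `Ψ` denotes the linear map `w ↦ (w_k - L w_(k-1))` (`unwind`), the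
vector of the first `N` errors is the value of `Ψ` at an integer translate of `Λ_N x`, where `Λ_N` is
`firstPowers L N` (`unwind_add_toReal`). The cell `V` of the quantizer contains exactly one integer
translate of every vector, and solving block by block shows the same for `W = Ψ⁻¹(V^N)`
(`isTile_preimage_unwind`). The condition `E(x) ∈ C` on the error vector therefore says that `Λ_N x`
lies in `Ψ⁻¹(C)` up to integer vectors. Moving `Ψ⁻¹(C)` into the unit cube piece by piece gives a
Jordan measurable set `cubeSet L C` with `{x | E(x) ∈ C} = quasiperiodicSet (cubeSet L C) Λ_N`
(`quasiperiodicSet_cubeSet`).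

All volumes agree. Rearranging a subset of one tile inside another preserves volume
(`IsTile.volume_inter_latticeSaturation`), so every Jordan measurable tile has volume one. In
particular both `W` and `V^N` have volume one, and the linear map `Ψ`, which multiplies volumes by a
constant, preserves them; no determinant is computed.

Frequencies come from Weyl's equidistribution theorem. Nonresonance says that no nontrivial
character of the torus is constant along the orbit `Λ_N x`, so its averages over boxes, which are
products of geometric sums, tend to zero as the shortest edge grows (`tendsto_avg_prod_zpow`).
Density of trigonometric polynomials turns this into weak convergence of the empirical measures on
the torus, and the portmanteau theorem gives the frequency of every set with negligible boundary
(`Nonresonant.freq_quasiperiodicSet`).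

Independence is the product formula for the volume of `B_1 × ⋯ × B_N`. For the equality of algebras,
a Jordan measurable set in the cube need not be Borel, but changing it within its boundary makes it
Borel without altering it on the countable range of the error vector
(`exists_measurableSet_inter_eq`).
-/

namespace QuantizedLinear

open Set Filter Topology

/-! ### Integer translates and tiles -/

section Lattice

variable {ι : Type*}

@[simp] theorem toReal_apply (z : ι → ℤ) (i : ι) : toReal z i = (z i : ℝ) := rfl

@[simp] theorem toReal_zero : toReal (0 : ι → ℤ) = 0 := by ext; simp

@[simp] theorem toReal_add (z w : ι → ℤ) : toReal (z + w) = toReal z + toReal w := by ext; simp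

@[simp] theorem toReal_neg (z : ι → ℤ) : toReal (-z) = -toReal z := by ext; simp

@[simp] theorem toReal_sub (z w : ι → ℤ) : toReal (z - w) = toReal z - toReal w := by ext; simp

/-- The union of all translates of `B` by integer vectors. -/
def latticeSaturation (B : Set (ι → ℝ)) : Set (ι → ℝ) :=
  ⋃ z : ι → ℤ, (fun u => u + toReal z) ⁻¹' B

theorem mem_latticeSaturation {B : Set (ι → ℝ)} {u : ι → ℝ} :
    u ∈ latticeSaturation B ↔ ∃ z : ι → ℤ, u + toReal z ∈ B := by
  simp [latticeSaturation]

theorem add_toReal_mem_latticeSaturation {B : Set (ι → ℝ)} {u : ι → ℝ} (z : ι → ℤ) :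
    u + toReal z ∈ latticeSaturation B ↔ u ∈ latticeSaturation B := by
  simp only [mem_latticeSaturation]
  constructor
  · rintro ⟨w, hw⟩
    exact ⟨z + w, by simpa [add_assoc] using hw⟩
  · rintro ⟨w, hw⟩
    exact ⟨w - z, by simpa [add_assoc] using hw⟩

/-- A set tiles the space by its integer translates if every vector has exactly one integer
translate in the set. -/
def IsTile (W : Set (ι → ℝ)) : Prop := ∀ u : ι → ℝ, ∃! z : ι → ℤ, u + toReal z ∈ W

theorem IsTile.eq_zero {W : Set (ι → ℝ)} (hW : IsTile W) {u : ι → ℝ} (hu : u ∈ W) {z : ι → ℤ}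
    (hz : u + toReal z ∈ W) : z = 0 :=
  (hW u).unique hz (by simpa using hu)

/-- A subset of a tile is recovered from its saturation. -/
theorem IsTile.inter_latticeSaturation {W B : Set (ι → ℝ)} (hW : IsTile W) (hB : B ⊆ W) :
    W ∩ latticeSaturation B = B := by
  ext u
  constructor
  · rintro ⟨hu, h⟩
    obtain ⟨z, hz⟩ := mem_latticeSaturation.1 h
    obtain rfl := hW.eq_zero hu (hB hz)
    simpa using hz
  · intro hu
    exact ⟨hB hu, mem_latticeSaturation.2 ⟨0, by simpa using hu⟩⟩

theorem IsTile.latticeSaturation_inter {W B : Set (ι → ℝ)} (hW : IsTile W) :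
    latticeSaturation (W ∩ latticeSaturation B) = latticeSaturation B := by
  ext u
  constructor
  · intro h
    obtain ⟨z, -, hz⟩ := mem_latticeSaturation.1 h
    exact (add_toReal_mem_latticeSaturation z).1 hz
  · intro h
    obtain ⟨z, hz, -⟩ := hW u
    exact mem_latticeSaturation.2 ⟨z, hz, (add_toReal_mem_latticeSaturation z).2 h⟩

theorem mem_quasiperiodicSet {n : ℕ} {G : Set (ι → ℝ)} {Λ : Matrix ι (Fin n) ℝ}
    {x : Fin n → ℤ} :
    x ∈ quasiperiodicSet G Λ ↔ Λ.mulVec (toReal x) ∈ latticeSaturation G := by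
  rw [mem_latticeSaturation]
  constructor
  · rintro ⟨u, hu, z, hz⟩
    exact ⟨-z, by simpa [hz] using hu⟩
  · rintro ⟨z, hz⟩
    exact ⟨_, hz, -z, by simp⟩

theorem IsTile.latticeSaturation_eq_univ {W : Set (ι → ℝ)} (hW : IsTile W) :
    latticeSaturation W = univ :=
  eq_univ_of_forall fun u => mem_latticeSaturation.2 (hW u).exists

/-- The half-open unit cube. -/
def unitCube (ι : Type*) : Set (ι → ℝ) := {u | ∀ i, u i ∈ Ico (0 : ℝ) 1}

theorem unitCube_eq_pi (ι : Type*) : unitCube ι = univ.pi fun _ => Ico (0 : ℝ) 1 := by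
  ext; simp [unitCube]

theorem isTile_unitCube : IsTile (unitCube ι) := by
  intro u
  refine ⟨fun i => -⌊u i⌋, fun i => ?_, fun z hz => ?_⟩
  · constructor <;> simp [← sub_eq_add_neg, Int.fract_lt_one]
  · ext i
    have h := hz i
    simp only [Pi.add_apply, toReal_apply, mem_Ico] at h
    have : ⌊u i⌋ = -z i := by
      rw [Int.floor_eq_iff]
      push_cast
      constructor <;> linarith
    simp [this]

variable [Fintype ι]

/-- Only finitely many integer translates of a bounded set meet a given ball. -/
theorem locallyFinite_translates {B : Set (ι → ℝ)} (hB : Bornology.IsBounded B) :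
    LocallyFinite fun z : ι → ℤ => (fun u => u + toReal z) ⁻¹' B := by
  classical
  intro x
  refine ⟨Metric.ball x 1, Metric.ball_mem_nhds x one_pos, ?_⟩
  obtain ⟨C, hC⟩ := hB.exists_norm_le
  refine (Set.finite_Icc (fun _ : ι => -⌈C + (‖x‖ + 1)⌉) (fun _ => ⌈C + (‖x‖ + 1)⌉)).subset ?_
  rintro z ⟨u, hu, hux⟩
  have h1 : ‖u + toReal z‖ ≤ C := hC _ hu
  have h2 : ‖u‖ ≤ ‖x‖ + 1 := by
    have : ‖u - x‖ < 1 := by simpa [dist_eq_norm] using hux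
    have h := norm_add_le x (u - x)
    rw [add_sub_cancel] at h
    linarith
  have h3 : ‖toReal z‖ ≤ C + (‖x‖ + 1) := by
    have h := norm_sub_le (u + toReal z) u
    rw [add_sub_cancel_left] at h
    linarith
  have h4 : ∀ i, |z i| ≤ ⌈C + (‖x‖ + 1)⌉ := fun i => by
    have := (norm_le_pi_norm (toReal z) i).trans h3
    have := this.trans (Int.le_ceil _)
    rw [toReal_apply, Real.norm_eq_abs] at this
    exact_mod_cast this
  exact ⟨fun i => (abs_le.1 (h4 i)).1, fun i => (abs_le.1 (h4 i)).2⟩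

theorem volume_frontier_latticeSaturation {B : Set (ι → ℝ)} (hB : JordanMeasurable B) :
    volume (frontier (latticeSaturation B)) = 0 := by
  have hsub : frontier (latticeSaturation B) ⊆
      ⋃ z : ι → ℤ, (fun u => u + toReal z) ⁻¹' frontier B := by
    intro x hx
    rw [latticeSaturation, frontier, (locallyFinite_translates hB.1).closure_iUnion] at hx
    obtain ⟨h1, h2⟩ := hx
    obtain ⟨z, hz⟩ := mem_iUnion.1 h1
    refine mem_iUnion.2 ⟨z, ?_⟩
    have e := (Homeomorph.addRight (toReal z)).preimage_frontier B
    simp only [Homeomorph.coe_addRight] at e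
    rw [e]
    exact ⟨hz, fun h => h2 (interior_mono (subset_iUnion _ z) h)⟩
  refine measure_mono_null hsub (measure_iUnion_null fun z => ?_)
  rw [measure_preimage_add_right]
  exact hB.2

theorem JordanMeasurable.inter_latticeSaturation {W B : Set (ι → ℝ)} (hW : JordanMeasurable W)
    (hB : JordanMeasurable B) : JordanMeasurable (W ∩ latticeSaturation B) := by
  refine ⟨hW.1.subset inter_subset_left, measure_mono_null (frontier_inter_subset _ _) ?_⟩
  refine measure_union_null (measure_mono_null inter_subset_left hW.2)
    (measure_mono_null inter_subset_right (volume_frontier_latticeSaturation hB))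

theorem JordanMeasurable.nullMeasurableSet {B : Set (ι → ℝ)} (hB : JordanMeasurable B) :
    NullMeasurableSet B volume :=
  nullMeasurableSet_of_null_frontier hB.2

/-- Cutting a subset of a tile along another tile and translating the pieces by integer vectors
preserves the volume. -/
theorem IsTile.volume_inter_latticeSaturation {W W' B : Set (ι → ℝ)} (hW : IsTile W)
    (hW' : IsTile W') (hJ' : JordanMeasurable W') (hBW : B ⊆ W) (hB : JordanMeasurable B) :
    volume (W' ∩ latticeSaturation B) = volume B := by
  have hmp : ∀ z : ι → ℤ, MeasurePreserving (fun u : ι → ℝ => u + toReal z) volume volume :=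
    fun z => measurePreserving_add_right volume (toReal z)
  have e1 : W' ∩ latticeSaturation B =
      ⋃ z : ι → ℤ, W' ∩ (fun u => u + toReal z) ⁻¹' B := by
    rw [latticeSaturation, inter_iUnion]
  have e2 : B = ⋃ z : ι → ℤ, (fun u => u + toReal z) ⁻¹' W' ∩ B := by
    rw [← iUnion_inter, eq_comm, inter_eq_right]
    intro u _
    obtain ⟨z, hz, -⟩ := hW' u
    exact mem_iUnion.2 ⟨z, hz⟩
  rw [e1, measure_iUnion₀]
  · conv_rhs => rw [e2]
    rw [measure_iUnion₀]
    · rw [← (Equiv.neg (ι → ℤ)).tsum_eq]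
      refine tsum_congr fun z => ?_
      rw [← (hmp (-z)).measure_preimage
        ((hJ'.nullMeasurableSet.preimage (hmp z).quasiMeasurePreserving).inter
          hB.nullMeasurableSet)]
      congr 1
      ext u
      simp
    · intro z w hzw
      refine Disjoint.aedisjoint (Set.disjoint_left.2 ?_)
      rintro u ⟨h1, -⟩ ⟨h2, -⟩
      exact hzw ((hW' u).unique h1 h2)
    · intro z
      exact (hJ'.nullMeasurableSet.preimage (hmp z).quasiMeasurePreserving).inter
        hB.nullMeasurableSet
  · intro z w hzw
    refine Disjoint.aedisjoint (Set.disjoint_left.2 ?_)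
    rintro u ⟨-, h1⟩ ⟨-, h2⟩
    exact hzw ((hW u).unique (hBW h1) (hBW h2))
  · intro z
    exact hJ'.nullMeasurableSet.inter
      (hB.nullMeasurableSet.preimage (hmp z).quasiMeasurePreserving)

theorem jordanMeasurable_unitCube : JordanMeasurable (unitCube ι) := by
  rw [unitCube_eq_pi]
  refine ⟨Bornology.IsBounded.pi fun _ => Metric.isBounded_Ico 0 1, ?_⟩
  exact (convex_pi fun _ _ => convex_Ico 0 1).addHaar_frontier volume

theorem volume_unitCube : volume (unitCube ι) = 1 := by
  rw [unitCube_eq_pi, volume_pi_pi]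
  simp

theorem IsTile.volume_eq_one {W : Set (ι → ℝ)} (hW : IsTile W) (hJ : JordanMeasurable W) :
    volume W = 1 := by
  have h := isTile_unitCube.volume_inter_latticeSaturation hW hJ subset_rfl
    (jordanMeasurable_unitCube (ι := ι))
  rwa [isTile_unitCube.latticeSaturation_eq_univ, inter_univ, volume_unitCube] at h

end Lattice

/-! ### Averages over large boxes as limits along a filter -/

section Boxes

variable {n : ℕ}

/-- The filter of boxes all of whose edges become long. -/
def boxFilter (n : ℕ) : Filter (Finset (Fin n → ℤ)) := ⨅ N : ℕ+, 𝓟 (largeBoxes n N)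

theorem largeBoxes_antitone : Antitone (largeBoxes n) := by
  rintro M N hMN P ⟨a, ℓ, hℓ, rfl⟩
  have h : (M : ℤ) ≤ (N : ℤ) := by exact_mod_cast hMN
  exact ⟨a, ℓ, fun k => h.trans (hℓ k), rfl⟩

theorem hasBasis_boxFilter : (boxFilter n).HasBasis (fun _ : ℕ+ => True) (largeBoxes n) :=
  hasBasis_iInf_principal largeBoxes_antitone.directed_ge

theorem card_box {a ℓ : Fin n → ℤ} : (box a ℓ).card = ∏ k, (ℓ k).toNat := by
  simp [box, Fintype.card_piFinset]

theorem nonempty_of_mem_largeBoxes {N : ℕ+} {P : Finset (Fin n → ℤ)} (hP : P ∈ largeBoxes n N) :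
    P.Nonempty := by
  obtain ⟨a, ℓ, hℓ, rfl⟩ := hP
  refine ⟨a, Fintype.mem_piFinset.2 fun k => Finset.mem_Ico.2 ⟨le_rfl, ?_⟩⟩
  have h1 : (0 : ℤ) < (N : ℤ) := by exact_mod_cast N.pos
  have h2 := hℓ k
  omega

instance nonempty_largeBoxes (N : ℕ+) : Nonempty (largeBoxes n N) :=
  ⟨⟨box 0 fun _ => N, 0, fun _ => N, fun _ => le_rfl, rfl⟩⟩

theorem avgOver_indicator_mem_Icc (A : Set (Fin n → ℤ)) (P : Finset (Fin n → ℤ)) :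
    avgOver (A.indicator fun _ => (1 : ℝ)) P ∈ Icc (0 : ℝ) 1 := by
  refine ⟨div_nonneg (Finset.sum_nonneg fun x _ => indicator_nonneg (by simp) x)
    (Nat.cast_nonneg _), div_le_one_of_le₀ ?_ (Nat.cast_nonneg _)⟩
  calc ∑ x ∈ P, A.indicator (fun _ => (1 : ℝ)) x ≤ ∑ _x ∈ P, (1 : ℝ) :=
        Finset.sum_le_sum fun x _ => indicator_le_self' (by simp) x
    _ = P.card := by simp

theorem freqMeasurable_of_tendsto {A : Set (Fin n → ℤ)} {c : ℝ}
    (h : Tendsto (avgOver (A.indicator fun _ => (1 : ℝ))) (boxFilter n) (𝓝 c)) :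
    FreqMeasurable A ∧ freq A = c := by
  set g := avgOver (A.indicator fun _ => (1 : ℝ)) with hg
  have hb : ∀ N : ℕ+, BddBelow (range fun P : largeBoxes n N => g P) := fun N =>
    ⟨0, by rintro _ ⟨P, rfl⟩; exact (avgOver_indicator_mem_Icc A P).1⟩
  have ha : ∀ N : ℕ+, BddAbove (range fun P : largeBoxes n N => g P) := fun N =>
    ⟨1, by rintro _ ⟨P, rfl⟩; exact (avgOver_indicator_mem_Icc A P).2⟩
  have key : ∀ ε : ℝ, 0 < ε → ∃ N : ℕ+, ∀ P ∈ largeBoxes n N, c - ε ≤ g P ∧ g P ≤ c + ε := by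
    intro ε hε
    have := h.eventually (Icc_mem_nhds (sub_lt_self c hε) (lt_add_of_pos_right c hε))
    obtain ⟨N, -, hN⟩ := hasBasis_boxFilter.eventually_iff.1 this
    exact ⟨N, fun P hP => hN hP⟩
  have hl : lowerAvg (A.indicator fun _ => (1 : ℝ)) = c := by
    apply le_antisymm
    · refine ciSup_le fun N => le_of_forall_pos_le_add fun ε hε => ?_
      obtain ⟨M, hM⟩ := key ε hε
      obtain ⟨P, hP⟩ := nonempty_largeBoxes (n := n) (max N M)
      exact ciInf_le_of_le (hb N) ⟨P, largeBoxes_antitone (le_max_left N M) hP⟩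
        (hM P (largeBoxes_antitone (le_max_right N M) hP)).2
    · refine le_of_forall_sub_le fun ε hε => ?_
      obtain ⟨M, hM⟩ := key ε hε
      refine le_ciSup_of_le (f := fun N : ℕ+ => ⨅ P : largeBoxes n N, g P) ⟨1, ?_⟩ M
        (le_ciInf fun P => (hM P P.2).1)
      rintro _ ⟨N, rfl⟩
      obtain ⟨P⟩ := nonempty_largeBoxes (n := n) N
      exact ciInf_le_of_le (hb N) P (avgOver_indicator_mem_Icc A P).2
  have hu : upperAvg (A.indicator fun _ => (1 : ℝ)) = c := by
    apply le_antisymm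
    · refine le_of_forall_pos_le_add fun ε hε => ?_
      obtain ⟨M, hM⟩ := key ε hε
      refine ciInf_le_of_le (f := fun N : ℕ+ => ⨆ P : largeBoxes n N, g P) ⟨0, ?_⟩ M
        (ciSup_le fun P => (hM P P.2).2)
      rintro _ ⟨N, rfl⟩
      obtain ⟨P⟩ := nonempty_largeBoxes (n := n) N
      exact le_ciSup_of_le (ha N) P (avgOver_indicator_mem_Icc A P).1
    · refine le_ciInf fun N => le_of_forall_sub_le fun ε hε => ?_
      obtain ⟨M, hM⟩ := key ε hε
      obtain ⟨P, hP⟩ := nonempty_largeBoxes (n := n) (max N M)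
      exact le_ciSup_of_le (ha N) ⟨P, largeBoxes_antitone (le_max_left N M) hP⟩
        (hM P (largeBoxes_antitone (le_max_right N M) hP)).1
  exact ⟨hl.trans hu.symm, hl⟩

end Boxes

/-! ### Exponential sums over boxes -/

section ExponentialSums

variable {n : ℕ}

theorem norm_sum_Ico_zpow_le_card {w : ℂ} (hw : ‖w‖ = 1) (a ℓ : ℤ) :
    ‖∑ t ∈ Finset.Ico a (a + ℓ), w ^ t‖ ≤ ℓ.toNat := by
  refine (norm_sum_le _ _).trans ?_
  simp [norm_zpow, hw]

theorem norm_sum_Ico_zpow_le {w : ℂ} (hw : ‖w‖ = 1) (hw1 : w ≠ 1) (a : ℤ) (ℓ : ℤ) :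
    ‖∑ t ∈ Finset.Ico a (a + ℓ), w ^ t‖ ≤ 2 / ‖w - 1‖ := by
  have hw0 : w ≠ 0 := by rintro rfl; simp at hw
  have hpos : 0 < ‖w - 1‖ := norm_pos_iff.2 (sub_ne_zero.2 hw1)
  rcases le_total ℓ 0 with hℓ | hℓ
  · rw [Finset.Ico_eq_empty (by omega)]
    simpa using by positivity
  obtain ⟨m, rfl⟩ := Int.eq_ofNat_of_zero_le hℓ
  have h : (∑ t ∈ Finset.Ico a (a + m), w ^ t) * (w - 1) = w ^ (a + m) - w ^ a := by
    induction m with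
    | zero => simp
    | succ m ih =>
      have hins : Finset.Ico a (a + ((m + 1 : ℕ) : ℤ)) = insert (a + m) (Finset.Ico a (a + m)) := by
        ext t; simp only [Finset.mem_Ico, Finset.mem_insert]; push_cast; omega
      rw [hins, Finset.sum_insert (by simp), add_mul, ih (by omega)]
      push_cast
      rw [← add_assoc, zpow_add_one₀ hw0]
      ring
  rw [le_div_iff₀ hpos, ← norm_mul, h]
  refine (norm_sub_le _ _).trans ?_
  simp only [norm_zpow, hw, one_zpow]
  norm_num

/-- The normalized exponential sum over a box factors into geometric sums, one per coordinate, and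
one nontrivial factor suffices to make it small. -/
theorem tendsto_avg_prod_zpow {w : Fin n → ℂ} (hw : ∀ j, ‖w j‖ = 1) {k : Fin n} (hk : w k ≠ 1) :
    Tendsto (fun P : Finset (Fin n → ℤ) => (∑ x ∈ P, ∏ j, w j ^ x j) / (P.card : ℂ))
      (boxFilter n) (𝓝 0) := by
  have hpos : 0 < ‖w k - 1‖ := norm_pos_iff.2 (sub_ne_zero.2 hk)
  rw [hasBasis_boxFilter.tendsto_iff Metric.nhds_basis_closedBall]
  intro ε hε
  obtain ⟨M, hM⟩ := exists_nat_gt (2 / ‖w k - 1‖ / ε)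
  refine ⟨⟨M + 1, Nat.succ_pos M⟩, trivial, ?_⟩
  rintro P ⟨a, ℓ, hℓ, rfl⟩
  have hℓ' : ∀ j, M + 1 ≤ (ℓ j).toNat := fun j => by
    have h1 := hℓ j
    rw [PNat.mk_coe] at h1
    omega
  have hℓr : ∀ j, (0 : ℝ) < (ℓ j).toNat := fun j => by
    exact_mod_cast (Nat.succ_pos M).trans_le (hℓ' j)
  rw [mem_closedBall_zero_iff, norm_div, Complex.norm_natCast, card_box, box,
    ← Finset.prod_univ_sum, norm_prod, Nat.cast_prod, ← Finset.prod_div_distrib]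
  rw [← Finset.mul_prod_erase _ _ (Finset.mem_univ k)]
  calc _ ≤ (2 / ‖w k - 1‖) / (M + 1) * 1 := by
        refine mul_le_mul ?_ ?_ (Finset.prod_nonneg fun j _ => by positivity) (by positivity)
        · refine div_le_div₀ (by positivity) (norm_sum_Ico_zpow_le (hw k) hk _ _) (by positivity) ?_
          exact_mod_cast hℓ' k
        · refine Finset.prod_le_one (fun j _ => by positivity) fun j _ => ?_
          exact div_le_one_of_le₀ (norm_sum_Ico_zpow_le_card (hw j) _ _) (by positivity)
    _ ≤ ε := by
        rw [mul_one, div_le_iff₀ (by positivity)]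
        rw [div_lt_iff₀ hε] at hM
        nlinarith

end ExponentialSums

/-! ### The torus -/

section Torus

variable {ι : Type*}

/-- The projection of the space onto the torus. -/
def toTorus : (ι → ℝ) → UnitAddTorus ι := Pi.map fun _ t => (t : UnitAddCircle)

theorem continuous_toTorus : Continuous (toTorus (ι := ι)) :=
  Continuous.piMap fun _ => AddCircle.continuous_mk' 1

theorem isOpenMap_toTorus [Finite ι] : IsOpenMap (toTorus (ι := ι)) :=
  IsOpenMap.piMap (fun _ => QuotientAddGroup.isOpenMap_coe)
    (Eventually.of_forall fun _ => QuotientAddGroup.mk_surjective)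

theorem toTorus_eq_iff {u v : ι → ℝ} : toTorus u = toTorus v ↔ ∃ z : ι → ℤ, u + toReal z = v := by
  constructor
  · intro h
    have h1 : ∀ i, ∃ m : ℤ, (m : ℝ) = v i - u i := fun i => by
      have h2 : ((v i - u i : ℝ) : UnitAddCircle) = 0 := by
        rw [AddCircle.coe_sub, sub_eq_zero]
        exact (congrFun h i).symm
      obtain ⟨m, hm⟩ := (AddCircle.coe_eq_zero_iff (1 : ℝ)).1 h2
      exact ⟨m, by simpa using hm⟩
    choose z hz using h1
    exact ⟨z, by ext i; simp [hz]⟩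
  · rintro ⟨z, rfl⟩
    ext i
    simp [toTorus]

theorem toTorus_preimage_image (B : Set (ι → ℝ)) :
    toTorus ⁻¹' (toTorus '' B) = latticeSaturation B := by
  ext u
  rw [mem_latticeSaturation]
  constructor
  · rintro ⟨v, hv, h⟩
    obtain ⟨z, hz⟩ := toTorus_eq_iff.1 h.symm
    exact ⟨z, hz ▸ hv⟩
  · rintro ⟨z, hz⟩
    exact ⟨_, hz, (toTorus_eq_iff.2 ⟨z, rfl⟩).symm⟩

theorem mFourier_toTorus [Fintype ι] (p : ι → ℤ) (u : ι → ℝ) :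
    UnitAddTorus.mFourier p (toTorus u) =
      ∏ i, Complex.exp (2 * Real.pi * Complex.I * p i * u i) := by
  simp only [UnitAddTorus.mFourier, toTorus, ContinuousMap.coe_mk, Pi.map_apply]
  refine Finset.prod_congr rfl fun i _ => ?_
  rw [fourier_coe_apply]
  simp

variable [Fintype ι]

/-- Lebesgue measure on the unit cube, transported to the torus. -/
noncomputable def torusMeasure (ι : Type*) [Fintype ι] : Measure (UnitAddTorus ι) :=
  (volume.restrict (unitCube ι)).map toTorus

instance isProbabilityMeasure_torusMeasure : IsProbabilityMeasure (torusMeasure ι) := by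
  have : IsProbabilityMeasure ((volume : Measure (ι → ℝ)).restrict (unitCube ι)) :=
    ⟨by rw [Measure.restrict_apply_univ, volume_unitCube]⟩
  exact Measure.isProbabilityMeasure_map continuous_toTorus.measurable.aemeasurable

/-- `torusMeasure` as a probability measure. -/
noncomputable def torusProbability (ι : Type*) [Fintype ι] : ProbabilityMeasure (UnitAddTorus ι) :=
  ⟨torusMeasure ι, inferInstance⟩

@[simp] theorem coe_torusProbability :
    (torusProbability ι : Measure (UnitAddTorus ι)) = torusMeasure ι := rfl

theorem integral_mFourier_torusMeasure {p : ι → ℤ} (hp : p ≠ 0) :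
    ∫ t, UnitAddTorus.mFourier p t ∂(torusMeasure ι) = 0 := by
  obtain ⟨k, hk⟩ := Function.ne_iff.1 hp
  rw [torusMeasure, integral_map continuous_toTorus.measurable.aemeasurable
    (UnitAddTorus.mFourier p).continuous.aestronglyMeasurable]
  simp_rw [mFourier_toTorus]
  rw [unitCube_eq_pi, volume_pi, Measure.restrict_pi_pi]
  rw [integral_fintype_prod_eq_prod
    (f := fun i (t : ℝ) => Complex.exp (2 * Real.pi * Complex.I * p i * t))]
  refine Finset.prod_eq_zero (Finset.mem_univ k) ?_
  have hc : 2 * Real.pi * Complex.I * p k ≠ 0 := by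
    have : (p k : ℂ) ≠ 0 := by exact_mod_cast hk
    exact mul_ne_zero Complex.two_pi_I_ne_zero this
  rw [integral_Ico_eq_integral_Ioc, ← intervalIntegral.integral_of_le zero_le_one,
    integral_exp_mul_complex hc]
  have : Complex.exp (2 * Real.pi * Complex.I * p k) = 1 :=
    Complex.exp_eq_one_iff.2 ⟨p k, by ring⟩
  simp [this]

/-- The projection is open and continuous, so the boundary of the image lifts to the boundary of the
saturation. -/
theorem torusMeasure_frontier_image {B : Set (ι → ℝ)} (hB : JordanMeasurable B) :
    torusMeasure ι (frontier (toTorus '' B)) = 0 := by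
  rw [torusMeasure, Measure.map_apply continuous_toTorus.measurable isClosed_frontier.measurableSet,
    isOpenMap_toTorus.preimage_frontier_eq_frontier_preimage continuous_toTorus,
    toTorus_preimage_image]
  exact Measure.restrict_le_self.absolutelyContinuous (volume_frontier_latticeSaturation hB)

theorem torusMeasure_image {G : Set (ι → ℝ)} (hG : G ⊆ unitCube ι) (hJ : JordanMeasurable G) :
    torusMeasure ι (toTorus '' G) = volume G := by
  rw [torusMeasure, Measure.map_apply₀ continuous_toTorus.measurable.aemeasurable
    (nullMeasurableSet_of_null_frontier (torusMeasure_frontier_image hJ)),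
    toTorus_preimage_image,
    Measure.restrict_apply₀' jordanMeasurable_unitCube.nullMeasurableSet,
    inter_comm, isTile_unitCube.inter_latticeSaturation hG]

end Torus

/-! ### Equidistribution of nonresonant orbits -/

section Empirical

variable {n : ℕ} {X : Type*} [MeasurableSpace X]

/-- The distribution of `φ x` for a uniformly random point `x` of the finite set `P`. -/
noncomputable def empiricalMeasure (φ : (Fin n → ℤ) → X)
    (P : {P : Finset (Fin n → ℤ) // P.Nonempty}) : ProbabilityMeasure X :=
  ⟨((P : Finset _).card : ENNReal)⁻¹ • ∑ x ∈ (P : Finset (Fin n → ℤ)), Measure.dirac (φ x), by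
    refine ⟨?_⟩
    simp only [Measure.smul_apply, Measure.coe_finsetSum, Finset.sum_apply, measure_univ,
      Finset.sum_const, nsmul_eq_mul, mul_one, smul_eq_mul]
    exact ENNReal.inv_mul_cancel (by exact_mod_cast P.2.card_ne_zero) (ENNReal.natCast_ne_top _)⟩

theorem integral_empiricalMeasure [MeasurableSingletonClass X] (φ : (Fin n → ℤ) → X)
    (P : {P : Finset (Fin n → ℤ) // P.Nonempty}) (f : X → ℂ) :
    ∫ t, f t ∂(empiricalMeasure φ P : Measure X) =
      (∑ x ∈ P.1, f (φ x)) / (P.1.card : ℂ) := by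
  simp only [empiricalMeasure, ProbabilityMeasure.coe_mk]
  rw [integral_smul_measure, integral_finsetSum_measure fun x _ => integrable_dirac (by simp)]
  simp [div_eq_inv_mul]

theorem empiricalMeasure_apply [MeasurableSingletonClass X] (φ : (Fin n → ℤ) → X)
    (P : {P : Finset (Fin n → ℤ) // P.Nonempty}) (S : Set X) :
    ((empiricalMeasure φ P : Measure X) S).toReal =
      avgOver ((φ ⁻¹' S).indicator fun _ => (1 : ℝ)) P.1 := by
  classical
  simp only [empiricalMeasure, ProbabilityMeasure.coe_mk]
  simp only [Measure.smul_apply, Measure.coe_finsetSum, Finset.sum_apply,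
    Measure.dirac_apply, smul_eq_mul, ENNReal.toReal_mul, ENNReal.toReal_inv,
    ENNReal.toReal_natCast, avgOver]
  rw [ENNReal.toReal_sum fun x _ => by by_cases h : φ x ∈ S <;> simp [h], div_eq_inv_mul]
  congr 1
  refine Finset.sum_congr rfl fun x _ => ?_
  by_cases h : φ x ∈ S <;> simp [h]

end Empirical

section Equidistribution

variable {n : ℕ} {ι : Type*} [Fintype ι]

/-- For a nonzero integer vector `p`, the row vector `p Λ` is not an integer vector. -/
theorem Nonresonant.not_integer {Λ : Matrix ι (Fin n) ℝ} (hΛ : Nonresonant Λ) {p : ι → ℤ}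
    (hp : p ≠ 0) : ∃ j, ∀ m : ℤ, ∑ i, (p i : ℝ) * Λ i j ≠ m := by
  by_contra! h
  choose q hq using h
  rw [Nonresonant, Fintype.linearIndependent_iff] at hΛ
  refine hp (funext fun i => ?_)
  have h0 := hΛ (Sum.elim (fun j => (-q j : ℚ)) fun i => (p i : ℚ)) ?_ (Sum.inr i)
  · simpa using h0
  · ext j
    have h1 : ∑ k, (q k : ℝ) * (1 : Matrix (Fin n) (Fin n) ℝ) k j = q j := by
      simp [Matrix.one_apply]
    have h2 := hq j
    simp only [Fintype.sum_sum_type, Finset.sum_apply, Pi.smul_apply, Sum.elim_inl,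
      Sum.elim_inr, Matrix.row, Rat.smul_def, Pi.zero_apply]
    push_cast
    simp only [neg_mul, Finset.sum_neg_distrib]
    change -(∑ k, (q k : ℝ) * (1 : Matrix (Fin n) (Fin n) ℝ) k j) + ∑ i, (p i : ℝ) * Λ i j = 0
    rw [h1, h2, neg_add_cancel]

theorem mFourier_toTorus_mulVec (p : ι → ℤ) (Λ : Matrix ι (Fin n) ℝ) (x : Fin n → ℤ) :
    UnitAddTorus.mFourier p (toTorus (Λ.mulVec (toReal x))) =
      ∏ j, Complex.exp (2 * Real.pi * Complex.I * ((∑ i, (p i : ℝ) * Λ i j : ℝ) : ℂ)) ^ x j := by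
  rw [mFourier_toTorus, ← Complex.exp_sum]
  simp_rw [← Complex.exp_int_mul]
  rw [← Complex.exp_sum]
  congr 1
  simp only [Matrix.mulVec, dotProduct, toReal_apply]
  push_cast
  simp only [Finset.mul_sum]
  rw [Finset.sum_comm]
  refine Finset.sum_congr rfl fun j _ => Finset.sum_congr rfl fun i _ => ?_
  ring

/-- Weyl's criterion for the characters of the torus. -/
theorem Nonresonant.tendsto_integral_mFourier {Λ : Matrix ι (Fin n) ℝ} (hΛ : Nonresonant Λ)
    (p : ι → ℤ) :
    Tendsto (fun P => ∫ t, UnitAddTorus.mFourier p t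
        ∂(empiricalMeasure (fun x => toTorus (Λ.mulVec (toReal x))) P : Measure (UnitAddTorus ι)))
      (comap Subtype.val (boxFilter n)) (𝓝 (∫ t, UnitAddTorus.mFourier p t ∂(torusMeasure ι))) := by
  by_cases hp : p = 0
  · subst hp
    simpa [UnitAddTorus.mFourier_zero] using tendsto_const_nhds
  rw [integral_mFourier_torusMeasure hp]
  simp_rw [integral_empiricalMeasure, mFourier_toTorus_mulVec]
  obtain ⟨k, hk⟩ := hΛ.not_integer hp
  refine (tendsto_avg_prod_zpow (w := fun j => Complex.exp (2 * Real.pi * Complex.I *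
    ((∑ i, (p i : ℝ) * Λ i j : ℝ) : ℂ))) (k := k) ?_ ?_).comp tendsto_comap
  · intro j
    rw [Complex.norm_exp]
    simp
  · intro h
    obtain ⟨m, hm⟩ := Complex.exp_eq_one_iff.1 h
    refine hk m ?_
    rw [mul_comm] at hm
    exact_mod_cast mul_right_cancel₀ Complex.two_pi_I_ne_zero hm

/-- The orbit of a nonresonant matrix is equidistributed on the torus. -/
theorem Nonresonant.tendsto_empiricalMeasure {Λ : Matrix ι (Fin n) ℝ} (hΛ : Nonresonant Λ) :
    Tendsto (empiricalMeasure fun x => toTorus (Λ.mulVec (toReal x)))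
      (comap Subtype.val (boxFilter n))
      (𝓝 (torusProbability ι)) := by
  set μ := empiricalMeasure fun x : Fin n → ℤ => toTorus (Λ.mulVec (toReal x)) with hμ
  have hint : ∀ (ν : Measure (UnitAddTorus ι)) [IsProbabilityMeasure ν]
      (f : C(UnitAddTorus ι, ℂ)), Integrable f ν := fun ν _ f =>
    f.continuous.integrable_of_hasCompactSupport (HasCompactSupport.of_compactSpace f)
  have hspan : ∀ g ∈ Submodule.span ℂ (range (UnitAddTorus.mFourier (d := ι))),
      Tendsto (fun P => ∫ t, g t ∂(μ P : Measure (UnitAddTorus ι)))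
        (comap Subtype.val (boxFilter n)) (𝓝 (∫ t, g t ∂(torusMeasure ι))) := by
    intro g hg
    induction hg using Submodule.span_induction with
    | mem g h => obtain ⟨p, rfl⟩ := h; exact hΛ.tendsto_integral_mFourier p
    | zero => simpa using tendsto_const_nhds
    | add f g _ _ hf hg =>
      simp only [ContinuousMap.add_apply]
      simp_rw [fun P => integral_add (hint (μ P) f) (hint (μ P) g)]
      rw [integral_add (hint _ f) (hint _ g)]
      exact hf.add hg
    | smul c g _ hg =>
      simp only [ContinuousMap.smul_apply, integral_smul]
      exact hg.const_smul c
  have hclose : ∀ (ν : Measure (UnitAddTorus ι)) [IsProbabilityMeasure ν]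
      (f g : C(UnitAddTorus ι, ℂ)), dist (∫ t, f t ∂ν) (∫ t, g t ∂ν) ≤ dist f g := by
    intro ν _ f g
    rw [dist_eq_norm, ← integral_sub (hint ν f) (hint ν g)]
    refine (norm_integral_le_of_norm_le_const (C := dist f g)
      (Eventually.of_forall fun t => ?_)).trans
      (by simp)
    rw [← dist_eq_norm]
    exact ContinuousMap.dist_apply_le_dist t
  rw [ProbabilityMeasure.tendsto_iff_forall_integral_rclike_tendsto ℂ]
  intro f
  rw [Metric.tendsto_nhds]
  intro ε hε
  have hf : f.toContinuousMap ∈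
      closure (Submodule.span ℂ (range (UnitAddTorus.mFourier (d := ι))) : Set _) := by
    rw [← Submodule.topologicalClosure_coe, UnitAddTorus.span_mFourier_closure_eq_top]
    trivial
  obtain ⟨g, hg, hfg⟩ := Metric.mem_closure_iff.1 hf (ε / 3) (by positivity)
  filter_upwards [(Metric.tendsto_nhds.1 (hspan g hg)) (ε / 3) (by positivity)] with P hP
  have h1 := hclose (μ P) f.toContinuousMap g
  have h2 := hclose (torusMeasure ι) g f.toContinuousMap
  rw [dist_comm g] at h2
  calc _ ≤ dist (∫ t, f t ∂(μ P : Measure (UnitAddTorus ι))) (∫ t, g t ∂(μ P : Measure _)) +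
          dist (∫ t, g t ∂(μ P : Measure (UnitAddTorus ι))) (∫ t, g t ∂(torusMeasure ι)) +
          dist (∫ t, g t ∂(torusMeasure ι)) (∫ t, f t ∂(torusMeasure ι)) := dist_triangle4 _ _ _ _
    _ < ε / 3 + ε / 3 + ε / 3 :=
        add_lt_add_of_lt_of_le (add_lt_add_of_le_of_lt (h1.trans hfg.le) hP) (h2.trans hfg.le)
    _ = ε := by ring

/-- Quasiperiodic sets of a nonresonant matrix have frequencies, given by the volume of the
defining subset of the unit cube. -/
theorem Nonresonant.freq_quasiperiodicSet {Λ : Matrix ι (Fin n) ℝ} (hΛ : Nonresonant Λ)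
    {G : Set (ι → ℝ)} (hG : G ⊆ unitCube ι) (hJ : JordanMeasurable G) :
    FreqMeasurable (quasiperiodicSet G Λ) ∧ freq (quasiperiodicSet G Λ) = volume.real G := by
  apply freqMeasurable_of_tendsto
  have h := ProbabilityMeasure.tendsto_measure_of_null_frontier_of_tendsto'
    hΛ.tendsto_empiricalMeasure (E := toTorus '' G) (torusMeasure_frontier_image hJ)
  have h' := (ENNReal.tendsto_toReal (measure_ne_top _ _)).comp h
  simp only [coe_torusProbability, torusMeasure_image hG hJ, Function.comp_def,
    empiricalMeasure_apply] at h'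
  have hset : quasiperiodicSet G Λ =
      (fun x => toTorus (Λ.mulVec (toReal x))) ⁻¹' (toTorus '' G) := by
    ext x
    rw [mem_quasiperiodicSet, ← toTorus_preimage_image]
    rfl
  rw [hset]
  refine (tendsto_comap'_iff ?_).1 h'
  exact hasBasis_boxFilter.mem_iff.2
    ⟨1, trivial, fun P hP => ⟨⟨P, nonempty_of_mem_largeBoxes hP⟩, rfl⟩⟩

end Equidistribution

/-! ### Jordan measurability under products, linear equivalences and restriction -/

instance isAddHaarMeasure_volume_pi_pi {κ ι : Type*} [Fintype κ] [Fintype ι] :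
    (volume : Measure (κ → ι → ℝ)).IsAddHaarMeasure :=
  Measure.pi.isAddHaarMeasure fun _ => volume

theorem JordanMeasurable.pi {κ ι : Type*} [Fintype κ] [Fintype ι] {B : κ → Set (ι → ℝ)}
    (hB : ∀ k, JordanMeasurable (B k)) : JordanMeasurable (univ.pi B) := by
  refine ⟨Bornology.IsBounded.pi fun k => (hB k).1, ?_⟩
  have hsub : frontier (univ.pi B) ⊆ ⋃ k, Function.eval k ⁻¹' frontier (B k) := by
    intro u hu
    rw [frontier, closure_pi_set, interior_pi_set finite_univ] at hu
    obtain ⟨h1, h2⟩ := hu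
    simp only [mem_univ_pi, not_forall] at h1 h2
    obtain ⟨k, hk⟩ := h2
    exact mem_iUnion.2 ⟨k, h1 k, hk⟩
  refine measure_mono_null hsub (measure_iUnion_null fun k => ?_)
  exact (Measure.quasiMeasurePreserving_eval (fun _ : κ => (volume : Measure (ι → ℝ)))
    k).preimage_null (hB k).2

section LinearEquivalence

variable {E F : Type*}
  [NormedAddCommGroup E] [NormedSpace ℝ E] [MeasureSpace E] [BorelSpace E]
  [(volume : Measure E).IsAddHaarMeasure]
  [NormedAddCommGroup F] [NormedSpace ℝ F] [FiniteDimensional ℝ F] [MeasureSpace F] [BorelSpace F]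
  [(volume : Measure F).IsAddHaarMeasure]

/-- Uniqueness of Haar measure; `S` need not be measurable. -/
theorem exists_volume_preimage_eq_mul (e : E ≃L[ℝ] F) :
    ∃ c : ENNReal, ∀ S : Set F, volume (e ⁻¹' S) = c * volume S := by
  have h := Measure.isAddLeftInvariant_eq_smul ((volume : Measure E).map e) (volume : Measure F)
  refine ⟨(((volume : Measure E).map e).addHaarScalarFactor (volume : Measure F) : ENNReal),
    fun S => ?_⟩
  have hS : (volume : Measure E).map e S = volume (e ⁻¹' S) :=
    e.toHomeomorph.toMeasurableEquiv.map_apply S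
  rw [← hS]
  exact (congrArg (fun ν : Measure F => ν S) h).trans (Measure.nnreal_smul_coe_apply _ _ _)

theorem JordanMeasurable.preimage {S : Set F} (hS : JordanMeasurable S) (e : E ≃L[ℝ] F) :
    JordanMeasurable (e ⁻¹' S) := by
  constructor
  · rw [← e.image_symm_eq_preimage]
    exact (e.symm : F →L[ℝ] E).lipschitz.isBounded_image hS.1
  · obtain ⟨c, hc⟩ := exists_volume_preimage_eq_mul e
    have h := e.toHomeomorph.preimage_frontier S
    simp only [ContinuousLinearEquiv.coe_toHomeomorph] at h
    rw [← h, hc, hS.2, mul_zero]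

end LinearEquivalence

section Restriction

theorem frontier_image_val_subset {X : Type*} [TopologicalSpace X] {V : Set X} (B : Set V) :
    frontier (Subtype.val '' B) ⊆ frontier V ∪ Subtype.val '' frontier B := by
  rintro x ⟨hx, hx'⟩
  by_cases hxV : x ∈ interior V
  · right
    refine ⟨⟨x, interior_subset hxV⟩, ⟨closure_subtype.2 hx, fun h => hx' ?_⟩, rfl⟩
    obtain ⟨O, hO, hOB⟩ := mem_nhds_subtype V ⟨x, interior_subset hxV⟩ B |>.1
      (mem_interior_iff_mem_nhds.1 h)
    rw [mem_interior_iff_mem_nhds]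
    filter_upwards [hO, mem_interior_iff_mem_nhds.1 hxV] with y hy hyV
    exact ⟨⟨y, hyV⟩, hOB hy, rfl⟩
  · left
    exact ⟨closure_mono (Subtype.coe_image_subset V B) hx, hxV⟩

theorem image_val_frontier_subset {X : Type*} [TopologicalSpace X] {V : Set X} (B : Set V) :
    Subtype.val '' frontier B ⊆ frontier (Subtype.val '' B) := by
  rintro _ ⟨x, ⟨hx, hx'⟩, rfl⟩
  refine ⟨closure_subtype.1 hx, fun h => hx' ?_⟩
  rw [mem_interior_iff_mem_nhds] at h ⊢
  filter_upwards [continuous_subtype_val.continuousAt.preimage_mem_nhds h] with y hy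
  obtain ⟨z, hz, hzy⟩ := hy
  rwa [← Subtype.val_injective hzy]

variable {E : Type*} [PseudoMetricSpace E] [MeasureSpace E] [BorelSpace E] {V : Set E}

theorem lebesgueOn_apply (hV : JordanMeasurable V) {B : Set V} (hB : MeasurableSet B) :
    lebesgueOn V B = volume (Subtype.val '' B) :=
  Measure.comap_apply₀ _ _ Subtype.val_injective
    (fun _ => MeasureTheory.Measure.MeasurableSet.nullMeasurableSet_subtype_coe
      (nullMeasurableSet_of_null_frontier hV.2)) hB.nullMeasurableSet

/-- On a Jordan measurable set, the continuity sets of Lebesgue measure are the Jordan measurable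
subsets. -/
theorem lebesgueOn_frontier_eq_zero_iff (hV : JordanMeasurable V) {B : Set V} :
    lebesgueOn V (frontier B) = 0 ↔ JordanMeasurable (Subtype.val '' B) := by
  rw [lebesgueOn_apply hV isClosed_frontier.measurableSet]
  constructor
  · intro h
    exact ⟨hV.1.subset (Subtype.coe_image_subset V B),
      measure_mono_null (frontier_image_val_subset B) (measure_union_null hV.2 h)⟩
  · intro h
    exact measure_mono_null (image_val_frontier_subset B) h.2

/-- A continuity set can be altered within its boundary to become Borel, without affecting its
trace on a given countable set. -/
theorem exists_measurableSet_inter_eq {X : Type*} [TopologicalSpace X] [MeasurableSpace X]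
    [BorelSpace X] [MeasurableSingletonClass X] (S : Set X) {C : Set X} (hC : C.Countable) :
    ∃ B, MeasurableSet B ∧ frontier B ⊆ frontier S ∧ ∀ x ∈ C, x ∈ B ↔ x ∈ S := by
  refine ⟨interior S ∪ (S ∩ C), isOpen_interior.measurableSet.union
    (hC.mono inter_subset_right).measurableSet, ?_, fun x hx => ⟨?_, fun h => Or.inr ⟨h, hx⟩⟩⟩
  · refine sdiff_subset_sdiff (closure_mono (union_subset interior_subset inter_subset_left)) ?_
    exact interior_maximal subset_union_left isOpen_interior
  · rintro (h | h)
    · exact interior_subset h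
    · exact h.1

end Restriction

/-! ### The cell of a quantizer -/

section Cell

variable {n : ℕ} (R : Quantizer n)

theorem Quantizer.mem_cell_iff {u : Fin n → ℝ} {z : Fin n → ℤ} :
    u + toReal z ∈ R.cell ↔ z = -R.toFun u := by
  rw [Quantizer.cell, mem_ofPred_eq, R.map_add_lattice, add_comm, add_eq_zero_iff_eq_neg]

theorem Quantizer.isTile_cell : IsTile R.cell := fun u =>
  ⟨-R.toFun u, R.mem_cell_iff.2 rfl, fun _ hz => R.mem_cell_iff.1 hz⟩

theorem Quantizer.jordanMeasurable_cell : JordanMeasurable R.cell := R.jordanMeasurable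

theorem Quantizer.volume_cell : volume R.cell = 1 :=
  R.isTile_cell.volume_eq_one R.jordanMeasurable_cell

theorem Quantizer.cellPow_eq_pi (N : ℕ) : R.cellPow N = univ.pi fun _ => R.cell := by
  ext; simp [Quantizer.cellPow]

theorem Quantizer.jordanMeasurable_cellPow (N : ℕ) : JordanMeasurable (R.cellPow N) := by
  rw [R.cellPow_eq_pi]
  exact JordanMeasurable.pi fun _ => R.jordanMeasurable_cell

theorem Quantizer.volume_cellPow (N : ℕ) : volume (R.cellPow N) = 1 := by
  rw [R.cellPow_eq_pi, volume_pi_pi]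
  simp [R.volume_cell]

end Cell

/-! ### The triangular change of variables -/

section Unwind

variable {n : ℕ} (L : Matrix (Fin n) (Fin n) ℝ) {N : ℕ}

/-- The block preceding the `k`th block of `w`, which is zero for the initial block. -/
def prevBlock (w : Fin N × Fin n → ℝ) (k : Fin N) : Fin n → ℝ :=
  if (k : ℕ) = 0 then 0 else fun i => w (⟨k - 1, by omega⟩, i)

theorem prevBlock_of_eq_zero (w : Fin N × Fin n → ℝ) {k : Fin N} (hk : (k : ℕ) = 0) :
    prevBlock w k = 0 := if_pos hk

theorem prevBlock_succ (w : Fin N × Fin n → ℝ) {j : ℕ} (hj : j + 1 < N) :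
    prevBlock w ⟨j + 1, hj⟩ = fun i => w (⟨j, by omega⟩, i) := if_neg (Nat.succ_ne_zero j)

/-- The linear map `w ↦ (w k - L w (k - 1))`, which recovers the quantization errors
`E (k + 1) = (L ^ (k + 1) x - T ^ (k + 1) x) - L (L ^ k x - T ^ k x)` from the integer translate
`L ^ (k + 1) x - T ^ (k + 1) x` of `L ^ (k + 1) x`. -/
def unwindLinear : (Fin N × Fin n → ℝ) →ₗ[ℝ] (Fin N → Fin n → ℝ) where
  toFun w k := (fun i => w (k, i)) - L.mulVec (prevBlock w k)
  map_add' v w := by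
    ext k i
    have : prevBlock (v + w) k = prevBlock v k + prevBlock w k := by
      unfold prevBlock; split_ifs <;> ext <;> simp
    simp only [this, Matrix.mulVec_add, Pi.add_apply, Pi.sub_apply]
    ring
  map_smul' c w := by
    ext k i
    have : prevBlock (c • w) k = c • prevBlock w k := by
      unfold prevBlock; split_ifs <;> ext <;> simp
    simp only [this, Matrix.mulVec_smul, Pi.smul_apply, Pi.sub_apply, smul_eq_mul,
      RingHom.id_apply]
    ring

theorem unwindLinear_apply (w : Fin N × Fin n → ℝ) (k : Fin N) :
    unwindLinear L w k = (fun i => w (k, i)) - L.mulVec (prevBlock w k) := rfl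

theorem unwindLinear_injective : Function.Injective (unwindLinear L (N := N)) := by
  rw [← LinearMap.ker_eq_bot, LinearMap.ker_eq_bot']
  intro w hw
  have key : ∀ (j : ℕ) (hj : j < N), (fun i => w (⟨j, hj⟩, i)) = 0 := by
    intro j
    induction j with
    | zero =>
      intro hj
      have h := congrFun hw ⟨0, hj⟩
      rw [unwindLinear_apply, prevBlock_of_eq_zero w rfl] at h
      simpa using h
    | succ j ih =>
      intro hj
      have h := congrFun hw ⟨j + 1, hj⟩
      rw [unwindLinear_apply, prevBlock_succ w hj, ih] at h
      simpa using h
  ext ⟨k, i⟩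
  exact congrFun (key k k.2) i

/-- `unwindLinear` as a continuous linear equivalence. -/
noncomputable def unwind (N : ℕ) : (Fin N × Fin n → ℝ) ≃L[ℝ] (Fin N → Fin n → ℝ) :=
  (LinearEquiv.ofInjectiveOfFinrankEq (unwindLinear L) (unwindLinear_injective L)
    (by simp [Module.finrank_pi_fintype])).toContinuousLinearEquiv

theorem unwind_apply (w : Fin N × Fin n → ℝ) (k : Fin N) :
    unwind L N w k = (fun i => w (k, i)) - L.mulVec (prevBlock w k) := rfl

variable (R : Quantizer n)

/-- The integer vector in each block is forced by the previous blocks, because the cell is a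
tile. -/
theorem isTile_preimage_unwind (N : ℕ) : IsTile (unwind L N ⁻¹' R.cellPow N) := by
  have hblock : ∀ (u : Fin N × Fin n → ℝ) (z : Fin N × Fin n → ℤ) (k : Fin N),
      unwind L N (u + toReal z) k ∈ R.cell ↔ (fun i => z (k, i)) =
        -R.toFun ((fun i => u (k, i)) - L.mulVec (prevBlock (u + toReal z) k)) := by
    intro u z k
    rw [← R.mem_cell_iff, unwind_apply]
    have : (fun i => (u + toReal z) (k, i)) - L.mulVec (prevBlock (u + toReal z) k) =
        (fun i => u (k, i)) - L.mulVec (prevBlock (u + toReal z) k) +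
          toReal (fun i => z (k, i)) := by
      ext i
      simp only [Pi.add_apply, Pi.sub_apply, toReal_apply]
      ring
    rw [this]
  intro u
  apply existsUnique_of_exists_of_unique
  · -- `U` extends `u` by zero to all indices, so that `Z` can be defined by recursion over `ℕ`.
    let U : ℕ → Fin n → ℝ := fun k i => if h : k < N then u (⟨k, h⟩, i) else 0
    have hU : ∀ k : Fin N, U k = fun i => u (k, i) := fun k => by ext i; simp [U]
    let Z : ℕ → Fin n → ℤ := fun k => Nat.rec (-R.toFun (U 0))
      (fun j z => -R.toFun (U (j + 1) - L.mulVec (U j + toReal z))) k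
    refine ⟨fun p => Z p.1 p.2, fun k => (hblock u _ k).2 ?_⟩
    rw [← hU]
    obtain ⟨k, hk⟩ := k
    cases k with
    | zero =>
      rw [prevBlock_of_eq_zero _ rfl, Matrix.mulVec_zero, sub_zero]
      rfl
    | succ j =>
      rw [prevBlock_succ]
      have : (fun i => (u + toReal fun p : Fin N × Fin n => Z p.1 p.2) (⟨j, by omega⟩, i)) =
          U j + toReal (Z j) := by
        ext i
        simp [U, show j < N by omega]
      rw [this]
  · intro z z' hz hz'
    have key : ∀ (j : ℕ) (hj : j < N), (fun i => z (⟨j, hj⟩, i)) = fun i => z' (⟨j, hj⟩, i) := by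
      intro j
      induction j with
      | zero =>
        intro hj
        rw [(hblock u z _).1 (hz ⟨0, hj⟩), (hblock u z' _).1 (hz' ⟨0, hj⟩),
          prevBlock_of_eq_zero _ rfl, prevBlock_of_eq_zero _ rfl]
      | succ j ih =>
        intro hj
        rw [(hblock u z _).1 (hz ⟨j + 1, hj⟩), (hblock u z' _).1 (hz' ⟨j + 1, hj⟩),
          prevBlock_succ _ hj, prevBlock_succ _ hj]
        have : (fun i => (u + toReal z) (⟨j, by omega⟩, i)) =
            fun i => (u + toReal z') (⟨j, by omega⟩, i) := by
          ext i
          have := congrFun (ih (by omega)) i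
          simp [this]
        rw [this]
    ext ⟨k, i⟩
    exact congrFun (key k k.2) i

/-- The change of variables preserves volume: it scales volume by a constant, and it relates two
sets of volume one. -/
theorem volume_preimage_unwind (N : ℕ) (R : Quantizer n) (S : Set (Fin N → Fin n → ℝ)) :
    volume (unwind L N ⁻¹' S) = volume S := by
  obtain ⟨c, hc⟩ := exists_volume_preimage_eq_mul (unwind L N)
  have h1 := (isTile_preimage_unwind L R N).volume_eq_one
    ((R.jordanMeasurable_cellPow N).preimage (unwind L N))
  rw [hc, R.volume_cellPow, mul_one] at h1
  rw [hc, h1, one_mul]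

end Unwind

/-! ### The error vector -/

section ErrorVector

variable {n : ℕ} (R : Quantizer n) (L : Matrix (Fin n) (Fin n) ℝ)

theorem coe_quantizationError_succ (k : ℕ) (x : Fin n → ℤ) :
    (quantizationError R L (k + 1) x : Fin n → ℝ) =
      L.mulVec (toReal ((transition R L)^[k] x)) - toReal ((transition R L)^[k + 1] x) := by
  rw [Function.iterate_succ_apply']
  rfl

/-- The error vector is obtained by unwinding the integer translate of the stacked vectors `L ^ k x`
whose `k`th block is `L ^ k x - T ^ k x`. -/
theorem unwind_add_toReal (N : ℕ) (x : Fin n → ℤ) :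
    unwind L N ((firstPowers L N).mulVec (toReal x) +
      toReal fun p => -(transition R L)^[(p.1 : ℕ) + 1] x p.2) = (errorVector R L N x).1 := by
  set w := (firstPowers L N).mulVec (toReal x) +
      toReal fun p => -(transition R L)^[(p.1 : ℕ) + 1] x p.2 with hw
  -- As `y 0 = 0`, the convention for the block preceding the initial one agrees with `y`.
  let y : ℕ → Fin n → ℝ := fun k =>
    (L ^ k).mulVec (toReal x) - toReal ((transition R L)^[k] x)
  have hwy : ∀ k : Fin N, (fun i => w (k, i)) = y (k + 1) := by
    intro k
    ext i
    simp only [hw, y, Pi.add_apply, toReal_apply, Pi.sub_apply, Int.cast_neg, ← sub_eq_add_neg]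
    rfl
  have hprev : ∀ k : Fin N, prevBlock w k = y k := by
    rintro ⟨k, hk⟩
    cases k with
    | zero => simp [prevBlock_of_eq_zero, y]
    | succ j => rw [prevBlock_succ, hwy]
  ext k : 1
  rw [unwind_apply, hprev, hwy]
  change _ = (quantizationError R L ((k : ℕ) + 1) x : Fin n → ℝ)
  rw [coe_quantizationError_succ]
  simp only [y, Matrix.mulVec_sub, Matrix.mulVec_mulVec, ← pow_succ']
  abel

/-- Membership up to integer vectors can be tested at the translate in the tile `Ψ⁻¹(V ^ N)`, whose
image is the error vector. -/
theorem mulVec_mem_latticeSaturation_iff {N : ℕ} {S : Set (Fin N × Fin n → ℝ)} (x : Fin n → ℤ) :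
    (firstPowers L N).mulVec (toReal x) ∈ latticeSaturation S ↔
      (errorVector R L N x).1 ∈
        (unwind L N).symm ⁻¹' (unwind L N ⁻¹' R.cellPow N ∩ latticeSaturation S) := by
  rw [← unwind_add_toReal, mem_preimage, ContinuousLinearEquiv.symm_apply_apply, mem_inter_iff,
    add_toReal_mem_latticeSaturation, iff_and_self]
  intro _
  rw [mem_preimage, unwind_add_toReal]
  exact (errorVector R L N x).2

/-- The subset of the unit cube corresponding to the set `C` of error vectors. -/
def cubeSet {N : ℕ} (C : Set (Fin N → Fin n → ℝ)) : Set (Fin N × Fin n → ℝ) :=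
  unitCube (Fin N × Fin n) ∩ latticeSaturation (unwind L N ⁻¹' C)

variable {L} in
theorem jordanMeasurable_cubeSet {N : ℕ} {C : Set (Fin N → Fin n → ℝ)}
    (hC : JordanMeasurable C) : JordanMeasurable (cubeSet L C) :=
  jordanMeasurable_unitCube.inter_latticeSaturation (hC.preimage _)

theorem volume_cubeSet {N : ℕ} {C : Set (Fin N → Fin n → ℝ)} (hC : JordanMeasurable C)
    (hCV : C ⊆ R.cellPow N) : volume (cubeSet L C) = volume C := by
  rw [cubeSet, (isTile_preimage_unwind L R N).volume_inter_latticeSaturation isTile_unitCube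
    jordanMeasurable_unitCube (preimage_mono hCV) (hC.preimage _), volume_preimage_unwind L N R]

theorem quasiperiodicSet_cubeSet {N : ℕ} {C : Set (Fin N → Fin n → ℝ)} (hCV : C ⊆ R.cellPow N) :
    quasiperiodicSet (cubeSet L C) (firstPowers L N) = {x | (errorVector R L N x).1 ∈ C} := by
  ext x
  rw [mem_quasiperiodicSet, cubeSet, isTile_unitCube.latticeSaturation_inter,
    mulVec_mem_latticeSaturation_iff R,
    (isTile_preimage_unwind L R N).inter_latticeSaturation (preimage_mono hCV)]
  simp

theorem setOf_errorVector_mem_forwardAlgebraUpTo {N : ℕ} {C : Set (Fin N → Fin n → ℝ)}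
    (hC : JordanMeasurable C) (hCV : C ⊆ R.cellPow N) :
    {x | (errorVector R L N x).1 ∈ C} ∈ forwardAlgebraUpTo L N :=
  ⟨cubeSet L C, inter_subset_left, jordanMeasurable_cubeSet hC,
    (quasiperiodicSet_cubeSet R L hCV).symm⟩

end ErrorVector

/-! ### Reindexing the rows -/

section Reindexing

variable {n : ℕ} {ι κ : Type*} [Fintype ι] [Fintype κ]

theorem Nonresonant.of_submatrix {Λ : Matrix ι (Fin n) ℝ} (e : κ ≃ ι)
    (h : Nonresonant (Λ.submatrix e id)) : Nonresonant Λ := by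
  have h' := LinearIndependent.comp h (Sum.map id e.symm) (Function.injective_id.sumMap
    e.symm.injective)
  refine (linearIndependent_equiv' (Equiv.refl _) ?_).2 h'
  ext (i | i) j
  · rfl
  · change Λ (e (e.symm i)) j = Λ i j
    rw [e.apply_symm_apply]

theorem mem_quasiperiodicAlgebra_submatrix {Λ : Matrix ι (Fin n) ℝ} (e : κ ≃ ι)
    {A : Set (Fin n → ℤ)} (hA : A ∈ quasiperiodicAlgebra Λ) :
    A ∈ quasiperiodicAlgebra (Λ.submatrix e id) := by
  obtain ⟨G, hG, hJ, rfl⟩ := hA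
  let f : (κ → ℝ) ≃L[ℝ] (ι → ℝ) := (LinearEquiv.funCongrLeft ℝ ℝ e.symm).toContinuousLinearEquiv
  have hf : ∀ (u : κ → ℝ) (i : ι), f u i = u (e.symm i) := fun _ _ => rfl
  refine ⟨f ⁻¹' G, fun u hu k => ?_, hJ.preimage f, ?_⟩
  · have := hG hu (e k)
    rwa [hf, e.symm_apply_apply] at this
  · ext x
    rw [mem_quasiperiodicSet, mem_quasiperiodicSet, mem_latticeSaturation, mem_latticeSaturation]
    refine (Equiv.arrowCongr e (Equiv.refl ℤ)).symm.exists_congr fun z => ?_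
    rw [mem_preimage]
    have : f ((Λ.submatrix e id).mulVec (toReal x) +
        toReal ((Equiv.arrowCongr e (Equiv.refl ℤ)).symm z)) = Λ.mulVec (toReal x) + toReal z := by
      ext i
      rw [hf]
      simp [Matrix.mulVec, dotProduct]
    rw [this]

end Reindexing

section Powers

variable {n : ℕ} {L : Matrix (Fin n) (Fin n) ℝ}

theorem IterativelyNonresonant.nonresonant_firstPowers (hn : 0 < n)
    (hL : IterativelyNonresonant L) {N : ℕ} (hN : 0 < N) : Nonresonant (firstPowers L N) := by
  -- The blocks of `firstPowers` are numbered from zero, with `L ^ (k + 1)` in the `k`th block.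
  let r : Fin N × Fin n ↪ {k : ℤ // k ≠ 0} × Fin n :=
    ⟨fun p => (⟨(p.1 : ℕ) + 1, by positivity⟩, p.2), by
      rintro ⟨a, i⟩ ⟨b, j⟩ h
      simp only [Prod.mk.injEq, Subtype.mk.injEq] at h
      ext <;> simp <;> omega⟩
  refine Nonresonant.of_submatrix finProdFinEquiv.symm ?_
  convert hL.nonresonant (N * n) (Nat.mul_pos hN hn)
    (finProdFinEquiv.symm.toEmbedding.trans r) using 1
  ext p j
  change (L ^ (((finProdFinEquiv.symm p).1 : ℕ) + 1)) _ _ =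
    (L ^ ((((finProdFinEquiv.symm p).1 : ℕ) : ℤ) + 1)) _ _
  rw [← Nat.cast_succ, zpow_natCast]
  rfl

theorem forwardAlgebraUpTo_subset_forwardAlgebra (hn : 0 < n) {N : ℕ} (hN : 0 < N) :
    forwardAlgebraUpTo L N ⊆ forwardAlgebra L := by
  intro A hA
  let r : Fin N × Fin n ↪ ℕ+ × Fin n :=
    ⟨fun p => (⟨(p.1 : ℕ) + 1, Nat.succ_pos _⟩, p.2), by
      rintro ⟨a, i⟩ ⟨b, j⟩ h
      have h1 : (a : ℕ) + 1 = b + 1 := congrArg (fun q : ℕ+ × Fin n => (q.1 : ℕ)) h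
      have h2 : i = j := congrArg Prod.snd h
      exact Prod.ext (Fin.ext (Nat.succ_injective h1)) h2⟩
  refine ⟨N * n, Nat.mul_pos hN hn, finProdFinEquiv.symm.toEmbedding.trans r, ?_⟩
  have h : (positivePowers L).submatrix (finProdFinEquiv.symm.toEmbedding.trans r) id =
      (firstPowers L N).submatrix finProdFinEquiv.symm id := by
    ext p j
    rfl
  rw [h]
  exact mem_quasiperiodicAlgebra_submatrix finProdFinEquiv.symm hA

end Powers

/-! ### Distribution and independence of the quantization errors -/

section Errors

variable {n : ℕ} (R : Quantizer n) {L : Matrix (Fin n) (Fin n) ℝ} {N : ℕ}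

/-- The frequency of a Jordan measurable condition on the error vector is its volume. -/
theorem freq_setOf_errorVector_mem (hΛ : Nonresonant (firstPowers L N))
    {C : Set (Fin N → Fin n → ℝ)} (hC : JordanMeasurable C) (hCV : C ⊆ R.cellPow N) :
    FreqMeasurable {x | (errorVector R L N x).1 ∈ C} ∧
      freq {x | (errorVector R L N x).1 ∈ C} = volume.real C := by
  have h := hΛ.freq_quasiperiodicSet (G := cubeSet L C) inter_subset_left
    (jordanMeasurable_cubeSet hC)
  rwa [quasiperiodicSet_cubeSet R L hCV, measureReal_def, volume_cubeSet R L hC hCV] at h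

theorem pi_subset_cellPow {B : Fin N → Set R.cell} :
    (univ.pi fun k => Subtype.val '' B k) ⊆ R.cellPow N := by
  intro u hu k
  exact Subtype.coe_image_subset _ _ (hu k trivial)

theorem setOf_errorVector_mem_pi (B : Fin N → Set R.cell) :
    {x | (errorVector R L N x).1 ∈ univ.pi fun k => Subtype.val '' B k} =
      ⋂ k : Fin N, quantizationError R L ((k : ℕ) + 1) ⁻¹' B k := by
  ext x
  simp only [mem_ofPred_eq, mem_univ_pi, mem_iInter, mem_preimage]
  exact forall_congr' fun k => Subtype.val_injective.mem_set_image

/-- The joint frequency of conditions on the single errors is the product of the volumes. -/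
theorem freq_iInter_preimage_quantizationError (hΛ : Nonresonant (firstPowers L N))
    {B : Fin N → Set R.cell} (hB : ∀ k, JordanMeasurable (Subtype.val '' B k)) :
    FreqMeasurable (⋂ k : Fin N, quantizationError R L ((k : ℕ) + 1) ⁻¹' B k) ∧
      freq (⋂ k : Fin N, quantizationError R L ((k : ℕ) + 1) ⁻¹' B k) =
        ∏ k, volume.real (Subtype.val '' B k : Set (Fin n → ℝ)) := by
  have h := freq_setOf_errorVector_mem R hΛ (JordanMeasurable.pi hB) (pi_subset_cellPow R)
  rwa [setOf_errorVector_mem_pi, measureReal_def, volume_pi_pi, ENNReal.toReal_prod] at h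

/-- A condition on a single error is a condition on the error vector whose other components are
unconstrained. -/
theorem preimage_quantizationError_eq_iInter (k : ℕ) (B : Set R.cell) :
    quantizationError R L (k + 1) ⁻¹' B = ⋂ j : Fin (k + 1),
      quantizationError R L ((j : ℕ) + 1) ⁻¹' Function.update (fun _ => univ) (Fin.last k) B j := by
  ext x
  simp only [mem_iInter, mem_preimage]
  constructor
  · intro h j
    rcases eq_or_ne j (Fin.last k) with rfl | hj
    · simpa using h
    · simp [hj]
  · intro h
    simpa using h (Fin.last k)

theorem jordanMeasurable_update (k : ℕ) {B : Set R.cell}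
    (hB : JordanMeasurable (Subtype.val '' B)) (j : Fin (k + 1)) :
    JordanMeasurable (Subtype.val ''
      (Function.update (fun _ => univ) (Fin.last k) B j : Set R.cell)) := by
  rcases eq_or_ne j (Fin.last k) with rfl | hj
  · simpa using hB
  · simpa [hj] using R.jordanMeasurable_cell

theorem freq_preimage_quantizationError {k : ℕ} (hΛ : Nonresonant (firstPowers L (k + 1)))
    {B : Set R.cell} (hB : JordanMeasurable (Subtype.val '' B)) :
    FreqMeasurable (quantizationError R L (k + 1) ⁻¹' B) ∧
      freq (quantizationError R L (k + 1) ⁻¹' B) =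
        volume.real (Subtype.val '' B : Set (Fin n → ℝ)) := by
  have h := freq_iInter_preimage_quantizationError R hΛ (jordanMeasurable_update R k hB)
  rw [← preimage_quantizationError_eq_iInter] at h
  refine ⟨h.1, h.2.trans ?_⟩
  rw [Finset.prod_eq_single_of_mem (Fin.last k) (Finset.mem_univ _), Function.update_self]
  intro j _ hj
  simp [Function.update_of_ne hj, measureReal_def, R.volume_cell]

theorem preimage_quantizationError_mem_forwardAlgebraUpTo (k : ℕ) {B : Set R.cell}
    (hB : JordanMeasurable (Subtype.val '' B)) :
    quantizationError R L (k + 1) ⁻¹' B ∈ forwardAlgebraUpTo L (k + 1) := by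
  rw [preimage_quantizationError_eq_iInter, ← setOf_errorVector_mem_pi]
  exact setOf_errorVector_mem_forwardAlgebraUpTo R L
    (JordanMeasurable.pi (jordanMeasurable_update R k hB)) (pi_subset_cellPow R)

/-- It suffices to know the frequencies of the preimages of Jordan measurable subsets. -/
theorem isDistributed_lebesgueOn {E : Type*} [PseudoMetricSpace E] [MeasureSpace E] [BorelSpace E]
    {V : Set E} (hV : JordanMeasurable V) (hV1 : volume V = 1) {g : (Fin n → ℤ) → V}
    (h : ∀ B : Set V, JordanMeasurable (Subtype.val '' B) →
      FreqMeasurable (g ⁻¹' B) ∧ freq (g ⁻¹' B) = volume.real (Subtype.val '' B)) :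
    IsDistributed g (lebesgueOn V) where
  isProbabilityMeasure := ⟨by
    rw [lebesgueOn_apply hV MeasurableSet.univ, image_univ, Subtype.range_coe, hV1]⟩
  freqMeasurable_preimage B _ hB := (h B ((lebesgueOn_frontier_eq_zero_iff hV).1 hB)).1
  freq_preimage B hBm hB := by
    rw [(h B ((lebesgueOn_frontier_eq_zero_iff hV).1 hB)).2, measureReal_def, measureReal_def,
      lebesgueOn_apply hV hBm]

theorem setOf_errorVector_mem_image (B : Set (R.cellPow N)) :
    {x | (errorVector R L N x).1 ∈ Subtype.val '' B} = errorVector R L N ⁻¹' B := by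
  ext x
  exact Subtype.val_injective.mem_set_image

theorem generatedAlgebra_errorVector :
    generatedAlgebra (errorVector R L N) (lebesgueOn (R.cellPow N)) = forwardAlgebraUpTo L N := by
  have hV := R.jordanMeasurable_cellPow N
  apply Subset.antisymm
  · rintro _ ⟨B, -, hB, rfl⟩
    rw [← setOf_errorVector_mem_image]
    exact setOf_errorVector_mem_forwardAlgebraUpTo R L
      ((lebesgueOn_frontier_eq_zero_iff hV).1 hB) (Subtype.coe_image_subset _ _)
  · rintro _ ⟨G, hG, hJ, rfl⟩
    have hJ' := ((hV.preimage (unwind L N)).inter_latticeSaturation hJ).preimage (unwind L N).symm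
    set S : Set (Fin N → Fin n → ℝ) :=
      (unwind L N).symm ⁻¹' (unwind L N ⁻¹' R.cellPow N ∩ latticeSaturation G) with hS
    have hSV : S ⊆ R.cellPow N := fun u hu => by simpa using hu.1
    have himage : (Subtype.val '' (Subtype.val ⁻¹' S : Set (R.cellPow N))) = S := by
      rw [Subtype.image_preimage_coe, inter_eq_right.2 hSV]
    -- The set `G`, hence `S`, need not be Borel, but only its trace on the countable range of the
    -- error vector matters.
    obtain ⟨B, hBm, hBS, hB⟩ := exists_measurableSet_inter_eq
      (Subtype.val ⁻¹' S : Set (R.cellPow N)) (countable_range (errorVector R L N))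
    refine ⟨B, hBm, measure_mono_null hBS
      ((lebesgueOn_frontier_eq_zero_iff hV).2 (by rwa [himage])), ?_⟩
    ext x
    rw [mem_quasiperiodicSet, mulVec_mem_latticeSaturation_iff R]
    exact (hB _ (mem_range_self x)).symm

end Errors

end QuantizedLinear

theorem mainTheorem1 {n : ℕ} (hn : 0 < n) (R : Quantizer n) (L : Matrix (Fin n) (Fin n) ℝ)
    (hL : IterativelyNonresonant L) :
    (∀ k : ℕ, 0 < k →
      IsDistributed (quantizationError R L k) (lebesgueOn R.cell) ∧
      generatedAlgebra (quantizationError R L k) (lebesgueOn R.cell) ⊆ forwardAlgebra L) ∧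
    (∀ N : ℕ, 0 < N →
      MutuallyIndependent (fun k : Fin N =>
        generatedAlgebra (quantizationError R L ((k : ℕ) + 1)) (lebesgueOn R.cell)) ∧
      IsDistributed (errorVector R L N) (lebesgueOn (R.cellPow N)) ∧
      generatedAlgebra (errorVector R L N) (lebesgueOn (R.cellPow N)) =
        forwardAlgebraUpTo L N) := by
  have hV := R.jordanMeasurable_cell
  have hΛ : ∀ {N : ℕ}, 0 < N → Nonresonant (firstPowers L N) := hL.nonresonant_firstPowers hn
  refine ⟨fun k hk => ?_, fun N hN => ⟨fun A hA => ?_, ?_, generatedAlgebra_errorVector R⟩⟩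
  · obtain ⟨k, rfl⟩ := Nat.exists_eq_succ_of_ne_zero hk.ne'
    refine ⟨isDistributed_lebesgueOn hV R.volume_cell fun B hB =>
      freq_preimage_quantizationError R (hΛ hk) hB, ?_⟩
    rintro _ ⟨B, -, hB, rfl⟩
    exact forwardAlgebraUpTo_subset_forwardAlgebra hn hk
      (preimage_quantizationError_mem_forwardAlgebraUpTo R k
        ((lebesgueOn_frontier_eq_zero_iff hV).1 hB))
  · choose B _ hB hAB using hA
    obtain rfl : A = fun k : Fin N => quantizationError R L ((k : ℕ) + 1) ⁻¹' B k := funext hAB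
    have hJ : ∀ k, JordanMeasurable (Subtype.val '' B k) := fun k =>
      (lebesgueOn_frontier_eq_zero_iff hV).1 (hB k)
    have hk : ∀ k : Fin N, _ := fun k =>
      freq_preimage_quantizationError R (hΛ k.val.succ_pos) (hJ k)
    have h := freq_iInter_preimage_quantizationError R (hΛ hN) hJ
    exact ⟨fun k => (hk k).1, h.1, h.2.trans (Finset.prod_congr rfl fun k _ => (hk k).2.symm)⟩
  · refine isDistributed_lebesgueOn (R.jordanMeasurable_cellPow N) (R.volume_cellPow N)
      fun B hB => ?_
    rw [← setOf_errorVector_mem_image]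
    exact freq_setOf_errorVector_mem R (hΛ hN) hB (Subtype.coe_image_subset _ _)
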